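/- Let $S_\infty$ be the group of all finite permutations of $\{0,1,2,\dots\}$, let $\sigma_i=(i-1,i)$ $(i\ge 1)$ be its Coxeter generators, and put $S_{n,\infty}=\langle\sigma_n,\sigma_{n+1},\dots\rangle$ for $n \ge 1$. For $k\ge 2$ let $m_k(\sigma)$ denote the number of $k$-cycles in the disjoint cycle decomposition of $\sigma\in S_\infty$. Let $\pi$ be a unitary representation of $S_\infty$ on a complex Hilbert space, let $\mathcal A$ be the von Neumann algebra generated by $\pi(S_\infty)$, and let $\mathrm{tr}$ be a faithful normal tracial state on $\mathcal A$. Put $v_1=\pi((0,1))$ and $$\mathcal A_{n}=\{x\in\mathcal A : \pi(g)\,x\,\pi(g)^*=x \text{ for all } g\in S_{n+2,\infty}\}\qquad(n\ge -1),$$ so that $\mathcal A_{-1}$ is the center of $\mathcal A$. **Theorem (Thoma multiplicativity).** For $n\in\{-1,0\}$ there is a unique $\mathrm{tr}$-preserving conditional expectation $E_n\colon\mathcal A\to\mathcal A_n$, and for every $\sigma\in S_\infty$ $$E_{-1}\big(\pi(\sigma)\big)=\prod_{k=2}^{\infty}\Big(E_{-1}\big((E_0(v_1))^{k-1}\big)\Big)^{m_k(\sigma)}.$$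 If $\mathcal A_{-1}\simeq\mathbb C$ (that is, if $\mathcal A$ is a factor), then $E_{-1}$ can be replaced by $\mathrm{tr}$ on both sides: $$\mathrm{tr}\big(\pi(\sigma)\big)=\prod_{k=2}^{\infty}\Big(\mathrm{tr}\big((E_0(v_1))^{k-1}\big)\Big)^{m_k(\sigma)}.$$ If $\mathcal A_{0}\simeq\mathbb C$, then $$\mathrm{tr}\big(\pi(\sigma)\big)=\prod_{k=2}^{\infty}\mathrm{tr}(v_1)^{(k-1)\,m_k(\sigma)}.$$ (All products have only finitely many factors different from $1$.) -/

import Mathlib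

noncomputable section

/-! ### The infinite symmetric group -/

/-- The infinite symmetric group `S_∞`: all finite permutations of `{0, 1, 2, …}`, with the product
`(σ * τ) n = σ (τ n)`. -/
def SInf : Subgroup (Equiv.Perm ℕ) where
  carrier := {σ | {n | σ n ≠ n}.Finite}
  one_mem' := by simp
  mul_mem' := by
    intro a b ha hb
    refine (Set.Finite.union ha hb).subset ?_
    intro n hn
    by_contra h
    simp only [Set.mem_union, Set.mem_ofPred_eq, not_or, not_not] at h
    exact hn (by rw [Equiv.Perm.mul_apply, h.2, h.1])
  inv_mem' := by
    intro a ha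
    refine Set.Finite.subset ha ?_
    intro n hn h
    exact hn (by rw [Equiv.Perm.inv_eq_iff_eq, h])

namespace SInf

theorem swap_mem (i j : ℕ) : Equiv.swap i j ∈ SInf := by
  refine Set.Finite.subset (Set.toFinite {i, j}) ?_
  intro n hn
  by_contra h
  simp only [Set.mem_insert_iff, Set.mem_singleton_iff, not_or] at h
  exact hn (Equiv.swap_apply_of_ne_of_ne h.1 h.2)

/-- The Coxeter generator `σ_i = (i - 1, i)` for `i ≥ 1` (and `σ_0` is the identity). -/
def coxeter (i : ℕ) : SInf := ⟨Equiv.swap (i - 1) i, swap_mem _ _⟩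

/-- The star generator `γ_i = (0, i)` for `i ≥ 1` (and `γ_0` is the identity). -/
def starGen (i : ℕ) : SInf := ⟨Equiv.swap 0 i, swap_mem _ _⟩

/-- The subgroup `S_{n,∞} = ⟨σ_n, σ_{n+1}, …⟩` of `S_∞`. -/
def tail (n : ℕ) : Subgroup SInf := Subgroup.closure {s | ∃ i, n ≤ i ∧ s = coxeter i}

/-- `m_k(σ)`: the number of `k`-cycles in the cycle decomposition of `σ`, for `k ≥ 2`. A cycle `c`
occurs in that decomposition iff it agrees with `σ` at every point that `c` moves; it is a `k`-cycle
iff it moves exactly `k` points. -/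
def cycleCount (k : ℕ) (σ : SInf) : ℕ :=
  {c : Equiv.Perm ℕ | c.IsCycle ∧ (∀ n, c n ≠ n → c n = (σ : Equiv.Perm ℕ) n) ∧
    {n | c n ≠ n}.ncard = k}.ncard

/-- Only finitely many `m_k(σ)` are nonzero, so products over `k ≥ 2` with exponents `m_k(σ)` have
only finitely many factors different from `1`. -/
theorem finite_cycleCount (σ : SInf) : {k | cycleCount k σ ≠ 0}.Finite := by
  have hσ : {n | (σ : Equiv.Perm ℕ) n ≠ n}.Finite := σ.2
  refine (Set.finite_Iic {n | (σ : Equiv.Perm ℕ) n ≠ n}.ncard).subset ?_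
  intro k hk
  obtain ⟨c, _, h2, rfl⟩ := Set.nonempty_of_ncard_ne_zero hk
  refine Set.ncard_le_ncard (fun n hn => ?_) hσ
  have h := h2 n hn
  show _ ≠ _
  rw [← h]
  exact hn

/-- `S_{1,∞} = S_∞`. -/
theorem tail_one : tail 1 = ⊤ := by
  set K : Subgroup (Equiv.Perm ℕ) := (tail 1).map SInf.subtype with hK
  have hadj : ∀ n : ℕ, Equiv.swap n (n + 1) ∈ K := fun n =>
    ⟨coxeter (n + 1), Subgroup.subset_closure ⟨n + 1, by omega, rfl⟩, by
      simp [coxeter]⟩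
  have hadd : ∀ d n : ℕ, Equiv.swap n (n + d) ∈ K := by
    intro d
    induction d with
    | zero =>
      intro n
      rw [add_zero, Equiv.swap_self]
      exact K.one_mem
    | succ d ih =>
      intro n
      exact SubmonoidClass.swap_mem_trans K (ih n) (hadj (n + d))
  have hall : ∀ x y : ℕ, Equiv.swap x y ∈ K := by
    intro x y
    rcases le_total x y with h | h
    · obtain ⟨d, rfl⟩ := Nat.exists_eq_add_of_le h
      exact hadd d x
    · obtain ⟨d, rfl⟩ := Nat.exists_eq_add_of_le h
      rw [Equiv.swap_comm]
      exact hadd d y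
  have hle : Subgroup.closure {σ : Equiv.Perm ℕ | σ.IsSwap} ≤ K := by
    rw [Subgroup.closure_le]
    rintro σ ⟨x, y, _, rfl⟩
    exact hall x y
  rw [eq_top_iff]
  rintro ⟨f, hf⟩ -
  have hf' : f ∈ Subgroup.closure {σ : Equiv.Perm ℕ | σ.IsSwap} :=
    mem_closure_isSwap'.2 hf
  obtain ⟨g, hg, hgf⟩ := hle hf'
  have : g = ⟨f, hf⟩ := Subtype.ext hgf
  exact this ▸ hg

end SInf

/-! ### Von Neumann algebras, traces, conditional expectations -/

namespace VonNeumannAlgebra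

variable {H : Type*} [NormedAddCommGroup H] [InnerProductSpace ℂ H] [CompleteSpace H]

/-- The unital *-algebra of the elements of a von Neumann algebra. -/
abbrev Elem (M : VonNeumannAlgebra H) : Type _ := ↥M.toStarSubalgebra

/-- The von Neumann algebra generated by a set of operators: the double commutant of the set
together with the adjoints of its elements. -/
def generated (S : Set (H →L[ℂ] H)) : VonNeumannAlgebra H where
  toStarSubalgebra :=
    StarSubalgebra.centralizer ℂ (StarSubalgebra.centralizer ℂ S : Set (H →L[ℂ] H))
  centralizer_centralizer' := by
    change Set.centralizer (Set.centralizer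
      ((StarSubalgebra.centralizer ℂ (StarSubalgebra.centralizer ℂ S : Set (H →L[ℂ] H)) :
        StarSubalgebra ℂ (H →L[ℂ] H)) : Set (H →L[ℂ] H))) =
      ((StarSubalgebra.centralizer ℂ (StarSubalgebra.centralizer ℂ S : Set (H →L[ℂ] H)) :
        StarSubalgebra ℂ (H →L[ℂ] H)) : Set (H →L[ℂ] H))
    rw [StarSubalgebra.coe_centralizer_centralizer, Set.centralizer_centralizer_centralizer]

/-- A linear functional on a von Neumann algebra is normal (ultraweakly continuous) if it is of the
form `x ↦ ∑ i, ⟪η i, x (ξ i)⟫` with `∑ ‖ξ i‖² < ∞` and `∑ ‖η i‖² < ∞`. -/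
def IsNormalFunctional (M : VonNeumannAlgebra H) (φ : M.Elem →ₗ[ℂ] ℂ) : Prop :=
  ∃ ξ η : ℕ → H, Summable (fun i => ‖ξ i‖ ^ 2) ∧ Summable (fun i => ‖η i‖ ^ 2) ∧
    ∀ x : M.Elem, HasSum (fun i => inner ℂ (η i) ((x : H →L[ℂ] H) (ξ i))) (φ x)

/-- Faithful normal tracial states on a von Neumann algebra. -/
structure IsFaithfulNormalTracialState (M : VonNeumannAlgebra H) (tr : M.Elem →ₗ[ℂ] ℂ) : Prop where
  nonneg : ∀ x : M.Elem, 0 ≤ (tr (star x * x)).re ∧ (tr (star x * x)).im = 0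
  map_one : tr 1 = 1
  faithful : ∀ x : M.Elem, tr (star x * x) = 0 → x = 0
  normal : M.IsNormalFunctional tr
  tracial : ∀ x y : M.Elem, tr (x * y) = tr (y * x)

/-- `E : M → N` is a conditional expectation onto the von Neumann subalgebra `N` of `M` (a positive
`N`-bimodule projection) that preserves the functional `φ`. -/
structure IsCondExp {M N : VonNeumannAlgebra H} (hNM : N.toStarSubalgebra ≤ M.toStarSubalgebra)
    (φ : M.Elem →ₗ[ℂ] ℂ) (E : M.Elem →ₗ[ℂ] N.Elem) : Prop where
  proj : ∀ y : N.Elem, E (StarSubalgebra.inclusion hNM y) = y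
  bimodule : ∀ (y z : N.Elem) (x : M.Elem),
    E (StarSubalgebra.inclusion hNM y * x * StarSubalgebra.inclusion hNM z) = y * E x * z
  positive : ∀ x : M.Elem, (E (star x * x) : H →L[ℂ] H).IsPositive
  preserves : ∀ x : M.Elem, φ (StarSubalgebra.inclusion hNM (E x)) = φ x

end VonNeumannAlgebra

/-! ### Unitary representations of `S_∞` -/

namespace SInf

open VonNeumannAlgebra

variable {H : Type*} [NormedAddCommGroup H] [InnerProductSpace ℂ H] [CompleteSpace H]

/-- The von Neumann algebra `A` generated by `π(S_∞)`. -/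
def repAlgebra (π : SInf →* unitary (H →L[ℂ] H)) : VonNeumannAlgebra H :=
  generated (Set.range fun g => (π g : H →L[ℂ] H))

theorem rep_mem (π : SInf →* unitary (H →L[ℂ] H)) (g : SInf) :
    (π g : H →L[ℂ] H) ∈ (repAlgebra π).toStarSubalgebra := by
  change (π g : H →L[ℂ] H) ∈
    ((StarSubalgebra.centralizer ℂ (StarSubalgebra.centralizer ℂ
      (Set.range fun g => (π g : H →L[ℂ] H)) : Set (H →L[ℂ] H)) :
        StarSubalgebra ℂ (H →L[ℂ] H)) : Set (H →L[ℂ] H))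
  rw [StarSubalgebra.coe_centralizer_centralizer]
  exact Set.subset_centralizer_centralizer (Or.inl ⟨g, rfl⟩)

/-- The unitary `π(g)`, as an element of `A`. -/
def rep (π : SInf →* unitary (H →L[ℂ] H)) (g : SInf) : (repAlgebra π).Elem :=
  ⟨π g, rep_mem π g⟩

theorem rep_conj_iff (π : SInf →* unitary (H →L[ℂ] H)) (g : SInf) (x : H →L[ℂ] H) :
    (π g : H →L[ℂ] H) * x * star (π g : H →L[ℂ] H) = x ↔
      (π g : H →L[ℂ] H) * x = x * (π g : H →L[ℂ] H) := by
  constructor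
  · intro h
    conv_rhs => rw [← h]
    rw [mul_assoc _ (star _), Unitary.coe_star_mul_self, mul_one]
  · intro h
    rw [h, mul_assoc, Unitary.mul_star_self_of_mem (π g).2, mul_one]

/-- The fixed point algebra `{x ∈ A | π(g) x π(g)* = x for all g ∈ G}` of the action `Ad π` of a
subgroup `G` of `S_∞` on `A`. -/
def fixedPoints (π : SInf →* unitary (H →L[ℂ] H)) (G : Subgroup SInf) : VonNeumannAlgebra H where
  carrier := {x | x ∈ (repAlgebra π).toStarSubalgebra ∧
    ∀ g ∈ G, (π g : H →L[ℂ] H) * x * star (π g : H →L[ℂ] H) = x}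
  mul_mem' := by
    rintro x y ⟨hx, hx'⟩ ⟨hy, hy'⟩
    refine ⟨mul_mem hx hy, fun g hg => ?_⟩
    have h1 := (rep_conj_iff π g x).1 (hx' g hg)
    have h2 := (rep_conj_iff π g y).1 (hy' g hg)
    rw [rep_conj_iff, ← mul_assoc, h1, mul_assoc, h2, mul_assoc]
  add_mem' := by
    rintro x y ⟨hx, hx'⟩ ⟨hy, hy'⟩
    refine ⟨add_mem hx hy, fun g hg => ?_⟩
    rw [mul_add, add_mul, hx' g hg, hy' g hg]
  algebraMap_mem' := by
    intro r
    refine ⟨algebraMap_mem _ r, fun g _ => ?_⟩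
    rw [rep_conj_iff]
    exact (Algebra.commutes r _).symm
  star_mem' := by
    rintro x ⟨hx, hx'⟩
    refine ⟨star_mem hx, fun g hg => ?_⟩
    have h := congrArg star (hx' g hg)
    simpa [mul_assoc] using h
  centralizer_centralizer' := by
    have key : {x : H →L[ℂ] H | x ∈ (repAlgebra π).toStarSubalgebra ∧
        ∀ g ∈ G, (π g : H →L[ℂ] H) * x * star (π g : H →L[ℂ] H) = x} =
        Set.centralizer (Set.centralizer (repAlgebra π : Set (H →L[ℂ] H)) ∪
          {u | ∃ g ∈ G, u = (π g : H →L[ℂ] H)}) := by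
      rw [Set.centralizer_union, VonNeumannAlgebra.centralizer_centralizer]
      ext x
      refine and_congr Iff.rfl ⟨?_, ?_⟩
      · rintro h _ ⟨g, hg, rfl⟩
        exact (rep_conj_iff π g x).1 (h g hg)
      · intro h g hg
        exact (rep_conj_iff π g x).2 (h _ ⟨g, hg, rfl⟩)
    change Set.centralizer (Set.centralizer {x : H →L[ℂ] H |
        x ∈ (repAlgebra π).toStarSubalgebra ∧
        ∀ g ∈ G, (π g : H →L[ℂ] H) * x * star (π g : H →L[ℂ] H) = x}) =
      {x : H →L[ℂ] H | x ∈ (repAlgebra π).toStarSubalgebra ∧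
        ∀ g ∈ G, (π g : H →L[ℂ] H) * x * star (π g : H →L[ℂ] H) = x}
    rw [key, Set.centralizer_centralizer_centralizer]

theorem fixedPoints_le (π : SInf →* unitary (H →L[ℂ] H)) (G : Subgroup SInf) :
    (fixedPoints π G).toStarSubalgebra ≤ (repAlgebra π).toStarSubalgebra :=
  fun _ hx => hx.1

/-- `A_{-1}`: the fixed points of `S_{1,∞} = S_∞` in `A`. -/
abbrev algNegOne (π : SInf →* unitary (H →L[ℂ] H)) : VonNeumannAlgebra H :=
  fixedPoints π (tail 1)

/-- `A_0`: the fixed points of `S_{2,∞}` in `A`. -/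
abbrev algZero (π : SInf →* unitary (H →L[ℂ] H)) : VonNeumannAlgebra H :=
  fixedPoints π (tail 2)

/-- The elements of `A_{-1}` are exactly the elements of the center of `A`. -/
theorem mem_algNegOne_iff (π : SInf →* unitary (H →L[ℂ] H)) (x : H →L[ℂ] H) :
    x ∈ (algNegOne π).toStarSubalgebra ↔ x ∈ (repAlgebra π).toStarSubalgebra ∧
      ∀ y ∈ (repAlgebra π).toStarSubalgebra, x * y = y * x := by
  refine and_congr Iff.rfl ⟨fun h y hy => ?_, fun h g _ => ?_⟩
  · refine (hy x (Or.inl ?_))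
    change x ∈ StarSubalgebra.centralizer ℂ _
    rw [StarSubalgebra.mem_centralizer_iff]
    have h' : ∀ g, (π g : H →L[ℂ] H) * x = x * (π g : H →L[ℂ] H) := fun g =>
      (rep_conj_iff π g x).1 (h g (by rw [tail_one]; trivial))
    rintro _ ⟨g, rfl⟩
    refine ⟨h' g, ?_⟩
    have h2 := h' g⁻¹
    rw [map_inv] at h2
    exact h2
  · exact (rep_conj_iff π g x).2 (h _ (rep_mem π g)).symm

/-- `A_{-1}` is commutative, so that products over a set of integers make sense in it. -/
instance instCommMonoidAlgNegOne (π : SInf →* unitary (H →L[ℂ] H)) :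
    CommMonoid (algNegOne π).Elem :=
  { (inferInstance : Monoid (algNegOne π).Elem) with
    mul_comm := fun x y => Subtype.ext
      (((mem_algNegOne_iff π x).1 x.2).2 y (fixedPoints_le π _ y.2)) }

end SInf

end

/-!
The proof compares traces `tr (w x)`, with `w` in a fixed point algebra `N`: by faithfulness of the
trace they determine `E x` (`IsCondExp.eq_of_trace_mul`), and by normality the trace is continuous
along bounded families that converge in the weak operator topology (`IsNormalFunctional.tendsto`).
Bounded families converge along ultrafilters (`exists_weakTendsto`).

*Existence.* Averaging `π(g) x π(g)*` over the finite subgroups `G ⊓ initial N` of `G` and letting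
`N` tend to infinity along an ultrafilter gives the conditional expectation onto the fixed points of
`G` (`exists_isCondExp`).

*Disjoint permutations.* If `σ` and `τ` are disjoint, then conjugation by permutations that commute
with `τ` pushes the support of `σ` to infinity. Such conjugates do not change the traces
`tr (z π(σ) π(τ))` for central `z`. Every fixed permutation commutes with all but finitely many
of the conjugates, so their weak limit is central, and therefore it is `E_{-1}(π(σ))`. Hence
`E_{-1}(π(σ τ)) = E_{-1}(π(σ)) E_{-1}(π(τ))` (`condExp_rep_mul_of_disjoint`).

*Cycles.* In the same way the transpositions `(0, N)` have a weak limit `a` in `A_0`, and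
`a = E_0(v_1)`. A cycle of length `k` is conjugate to one that moves `0`, which is a product of
`k - 1` distinct transpositions `(0, i)` (`exists_starGen_prod`). In a trace against an element of `A_0` the
leading transposition `(0, i)` can be conjugated to `(0, N)` by `(i, N)`, which commutes with
everything else, and so be replaced by `a`; since `a` belongs to `A_0`, this can be repeated until
only `a ^ (k - 1)` is left (`exists_star_limit`, `condExp_rep_cycle`).

The two facts combine along the cycle decomposition (`eq_finprod_of_disjoint_mul`). When the center
is trivial, the trace is multiplicative on it, and the same argument applies to the trace itself.
-/

open Filter Topology

/-! ### Limits in the weak operator topology -/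

namespace VonNeumannAlgebra

variable {H : Type*} [NormedAddCommGroup H] [InnerProductSpace ℂ H]
variable {ι : Type*} {l : Filter ι}

/-- Convergence of a family of operators in the weak operator topology, expressed by matrix
coefficients. -/
def WeakTendsto (x : ι → H →L[ℂ] H) (l : Filter ι) (y : H →L[ℂ] H) : Prop :=
  ∀ ξ η : H, Tendsto (fun i => inner ℂ η (x i ξ)) l (𝓝 (inner ℂ η (y ξ)))

namespace WeakTendsto

variable {x x' : ι → H →L[ℂ] H} {y y' : H →L[ℂ] H}

theorem unique [l.NeBot] (h : WeakTendsto x l y) (h' : WeakTendsto x l y') : y = y' := by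
  ext ξ
  exact ext_inner_left ℂ fun η => tendsto_nhds_unique (h ξ η) (h' ξ η)

theorem congr' (h : WeakTendsto x l y) (hx : ∀ᶠ i in l, x i = x' i) : WeakTendsto x' l y :=
  fun ξ η => (h ξ η).congr' (hx.mono fun i hi => by rw [hi])

theorem const (y : H →L[ℂ] H) : WeakTendsto (fun _ : ι => y) l y :=
  fun _ _ => tendsto_const_nhds

theorem add (h : WeakTendsto x l y) (h' : WeakTendsto x' l y') :
    WeakTendsto (fun i => x i + x' i) l (y + y') := fun ξ η => by
  simpa only [add_apply, inner_add_right] using (h ξ η).add (h' ξ η)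

theorem smul (h : WeakTendsto x l y) (c : ℂ) : WeakTendsto (fun i => c • x i) l (c • y) :=
  fun ξ η => by
    simpa only [smul_apply, inner_smul_right] using (h ξ η).const_mul c

theorem mul_right (h : WeakTendsto x l y) (a : H →L[ℂ] H) :
    WeakTendsto (fun i => x i * a) l (y * a) := fun ξ η => h (a ξ) η

theorem isPositive [l.NeBot] (h : WeakTendsto x l y) (hx : ∀ i, (x i).IsPositive) :
    y.IsPositive := by
  have key : ∀ ξ : H, (0 : ℝ) ≤ (inner ℂ ξ (y ξ)).re ∧ (inner ℂ ξ (y ξ)).im = 0 := fun ξ => by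
    have hpos : ∀ i, (0 : ℝ) ≤ (inner ℂ ξ (x i ξ)).re ∧ (inner ℂ ξ (x i ξ)).im = 0 := fun i => by
      have := (hx i).inner_nonneg_right ξ
      exact ⟨(Complex.le_def.1 this).1, (Complex.le_def.1 this).2.symm⟩
    refine ⟨ge_of_tendsto ((Complex.continuous_re.tendsto _).comp (h ξ ξ))
      (Eventually.of_forall fun i => (hpos i).1), ?_⟩
    refine tendsto_nhds_unique ((Complex.continuous_im.tendsto _).comp (h ξ ξ))
      (tendsto_const_nhds.congr fun i => ((hpos i).2).symm)
  rw [ContinuousLinearMap.isPositive_iff_complex]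
  intro ξ
  obtain ⟨h1, h2⟩ := key ξ
  have hconj : inner ℂ (y ξ) ξ = inner ℂ ξ (y ξ) := by
    rw [← inner_conj_symm]
    exact Complex.conj_eq_iff_im.2 h2
  rw [hconj]
  exact ⟨Complex.conj_eq_iff_re.1 (Complex.conj_eq_iff_im.2 h2), h1⟩

variable [CompleteSpace H]

theorem mul_left (h : WeakTendsto x l y) (a : H →L[ℂ] H) :
    WeakTendsto (fun i => a * x i) l (a * y) := fun ξ η => by
  simpa only [mul_apply_eq_comp, ContinuousLinearMap.adjoint_inner_left] using
    h ξ (ContinuousLinearMap.adjoint a η)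

theorem commute [l.NeBot] (h : WeakTendsto x l y) {b : H →L[ℂ] H}
    (hb : ∀ᶠ i in l, b * x i = x i * b) : b * y = y * b :=
  ((h.mul_left b).congr' hb).unique (h.mul_right b)

/-- A von Neumann algebra is closed in the weak operator topology, being a commutant. -/
theorem mem [l.NeBot] (h : WeakTendsto x l y) (M : VonNeumannAlgebra H)
    (hx : ∀ i, x i ∈ M.toStarSubalgebra) : y ∈ M.toStarSubalgebra := by
  have hy : y ∈ Set.centralizer (Set.centralizer (M : Set (H →L[ℂ] H))) := fun b hb =>
    h.commute (Eventually.of_forall fun i => (hb (x i) (hx i)).symm)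
  rw [VonNeumannAlgebra.centralizer_centralizer] at hy
  exact hy

end WeakTendsto

variable [CompleteSpace H]

/-- Weak operator compactness of balls: a bounded family of operators converges along every
ultrafilter. -/
theorem exists_weakTendsto (U : Ultrafilter ι) (x : ι → H →L[ℂ] H) (C : ℝ)
    (hx : ∀ i, ‖x i‖ ≤ C) : ∃ y, WeakTendsto x U y := by
  have hbd : ∀ i (v w : H), ‖inner ℂ (x i v) w‖ ≤ C * ‖v‖ * ‖w‖ := fun i v w =>
    (norm_inner_le_norm _ _).trans (by
      gcongr
      exact (x i).le_of_opNorm_le (hx i) v)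
  have hlim : ∀ v w : H, ∃ c : ℂ, ‖c‖ ≤ C * ‖v‖ * ‖w‖ ∧
      Tendsto (fun i => inner ℂ (x i v) w) U (𝓝 c) := by
    intro v w
    obtain ⟨c, hc, hU⟩ := (isCompact_closedBall (0 : ℂ) (C * ‖v‖ * ‖w‖)).ultrafilter_le_nhds
      (U.map fun i => inner ℂ (x i v) w) (by
        rw [le_principal_iff]
        rw [Ultrafilter.coe_map, mem_map]
        exact Eventually.of_forall fun i => by simpa using hbd i v w)
    exact ⟨c, by simpa using hc, hU⟩
  choose B hB hBU using hlim
  let S : H →L⋆[ℂ] H →L[ℂ] ℂ := LinearMap.mkContinuous₂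
    (LinearMap.mk₂'ₛₗ (starRingEnd ℂ) (RingHom.id ℂ) B
      (fun v v' w => tendsto_nhds_unique (hBU _ _) (((hBU v w).add (hBU v' w)).congr fun i => by
        rw [map_add, inner_add_left]))
      (fun c v w => tendsto_nhds_unique (hBU _ _) (((hBU v w).const_mul (starRingEnd ℂ c)).congr
        fun i => by rw [map_smul, inner_smul_left]))
      (fun v w w' => tendsto_nhds_unique (hBU _ _) (((hBU v w).add (hBU v w')).congr fun i => by
        rw [inner_add_right]))
      (fun c v w => tendsto_nhds_unique (hBU _ _) (((hBU v w).const_mul c).congr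
        fun i => by rw [inner_smul_right]))) C hB
  refine ⟨InnerProductSpace.continuousLinearMapOfBilin S, fun ξ η => ?_⟩
  have h1 : inner ℂ (InnerProductSpace.continuousLinearMapOfBilin S ξ) η = B ξ η :=
    InnerProductSpace.continuousLinearMapOfBilin_apply S ξ η
  rw [← inner_conj_symm, h1]
  refine ((Complex.continuous_conj.tendsto _).comp (hBU ξ η)).congr fun i => ?_
  exact inner_conj_symm _ _

/-- Normal functionals are weak operator continuous on bounded sets. -/
theorem IsNormalFunctional.tendsto {M : VonNeumannAlgebra H} {φ : M.Elem →ₗ[ℂ] ℂ}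
    (hφ : M.IsNormalFunctional φ) {x : ι → M.Elem} {y : M.Elem} {C : ℝ}
    (hC : ∀ i, ‖(x i : H →L[ℂ] H)‖ ≤ C)
    (h : WeakTendsto (fun i => (x i : H →L[ℂ] H)) l (y : H →L[ℂ] H)) :
    Tendsto (fun i => φ (x i)) l (𝓝 (φ y)) := by
  obtain ⟨ξ, η, hξ, hη, hs⟩ := hφ
  have heq : ∀ z : M.Elem, φ z = ∑' i, inner ℂ (η i) ((z : H →L[ℂ] H) (ξ i)) :=
    fun z => (hs z).tsum_eq.symm
  simp only [heq]
  refine tendsto_tsum_of_dominated_convergence (bound := fun i => C * (‖ξ i‖ ^ 2 + ‖η i‖ ^ 2))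
    ((hξ.add hη).mul_left C) (fun k => h _ _) (Eventually.of_forall fun n k => ?_)
  have h0 : 0 ≤ C := (norm_nonneg _).trans (hC n)
  calc ‖inner ℂ (η k) ((x n : H →L[ℂ] H) (ξ k))‖ ≤ ‖η k‖ * (C * ‖ξ k‖) :=
        (norm_inner_le_norm _ _).trans (by
          gcongr
          exact (x n : H →L[ℂ] H).le_of_opNorm_le (hC n) _)
    _ = C * (‖ξ k‖ * ‖η k‖) := by ring
    _ ≤ C * (‖ξ k‖ ^ 2 + ‖η k‖ ^ 2) := by
        gcongr
        nlinarith [sq_nonneg (‖ξ k‖ - ‖η k‖), sq_nonneg ‖ξ k‖, sq_nonneg ‖η k‖]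

/-- Normal functionals pass to weak operator limits of bounded families inside a product. -/
theorem IsNormalFunctional.tendsto_mul_mul {M : VonNeumannAlgebra H} {φ : M.Elem →ₗ[ℂ] ℂ}
    (hφ : M.IsNormalFunctional φ) {x : ι → M.Elem} {y : M.Elem} {C : ℝ}
    (hC : ∀ i, ‖(x i : H →L[ℂ] H)‖ ≤ C)
    (h : WeakTendsto (fun i => (x i : H →L[ℂ] H)) l (y : H →L[ℂ] H)) (a b : M.Elem) :
    Tendsto (fun i => φ (a * x i * b)) l (𝓝 (φ (a * y * b))) := by
  refine hφ.tendsto (C := ‖(a : H →L[ℂ] H)‖ * C * ‖(b : H →L[ℂ] H)‖) (fun i => ?_)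
    ((h.mul_left (a : H →L[ℂ] H)).mul_right (b : H →L[ℂ] H))
  calc ‖(a : H →L[ℂ] H) * (x i : H →L[ℂ] H) * (b : H →L[ℂ] H)‖
      ≤ ‖(a : H →L[ℂ] H) * (x i : H →L[ℂ] H)‖ * ‖(b : H →L[ℂ] H)‖ := norm_mul_le _ _
    _ ≤ _ := by
      gcongr
      exact (norm_mul_le _ _).trans (by gcongr; exact hC i)

end VonNeumannAlgebra

/-! ### Cycles of finite permutations -/

namespace SInf

open Equiv Equiv.Perm

theorem apply_zpow_apply_ne {c : Perm ℕ} {x : ℕ} (hx : c x ≠ x) (n : ℤ) :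
    c ((c ^ n) x) ≠ (c ^ n) x := fun hn => hx (by
  apply (c ^ n).injective
  rw [← Perm.mul_apply] at hn ⊢
  rwa [((Commute.refl c).zpow_left n).eq])

/-- A permutation that agrees with `σ` on the points it moves has the same orbits there as `σ`. -/
theorem zpow_apply_eq_of_agree {c σ : Perm ℕ} (h : ∀ n, c n ≠ n → c n = σ n) {x : ℕ}
    (hx : c x ≠ x) (n : ℤ) : (c ^ n) x = (σ ^ n) x := by
  induction n with
  | zero => rfl
  | succ n ih =>
    rw [add_comm, zpow_add, zpow_add, Perm.mul_apply, Perm.mul_apply, ← ih, zpow_one, zpow_one]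
    exact h _ (apply_zpow_apply_ne hx _)
  | pred n ih =>
    have e : ∀ τ : Perm ℕ, τ ((τ ^ (-(n : ℤ) - 1)) x) = (τ ^ (-(n : ℤ))) x := fun τ => by
      rw [← Perm.mul_apply, ← zpow_one_add]
      congr 2
      ring
    apply σ.injective
    rw [e σ, ← ih, ← e c]
    exact (h _ (apply_zpow_apply_ne hx _)).symm

/-- Two cycles of `σ` that move a common point are equal. -/
theorem cycle_eq_of_agree {c d σ : Perm ℕ} (hc : c.IsCycle) (hd : d.IsCycle)
    (hcσ : ∀ n, c n ≠ n → c n = σ n) (hdσ : ∀ n, d n ≠ n → d n = σ n) {x : ℕ}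
    (hcx : c x ≠ x) (hdx : d x ≠ x) : c = d := by
  have key : ∀ {c d : Perm ℕ}, c.IsCycle → (∀ n, c n ≠ n → c n = σ n) →
      (∀ n, d n ≠ n → d n = σ n) → c x ≠ x → d x ≠ x → ∀ y, c y ≠ y → d y ≠ y := by
    intro c d hc hcσ hdσ hcx hdx y hy
    obtain ⟨n, rfl⟩ := hc.exists_zpow_eq hcx hy
    rw [zpow_apply_eq_of_agree hcσ hcx, ← zpow_apply_eq_of_agree hdσ hdx]
    exact apply_zpow_apply_ne hdx n
  ext y
  by_cases hy : c y = y
  · have : d y = y := by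
      by_contra h
      exact key hd hdσ hcσ hdx hcx y h hy
    rw [hy, this]
  · rw [hcσ y hy, hdσ y (key hc hcσ hdσ hcx hdx y hy)]

/-- Splitting off one cycle: a finite permutation with a moved point is the disjoint product of a
cycle and a permutation with smaller support. -/
theorem exists_cycle_mul (σ : SInf) (hσ : σ ≠ 1) : ∃ c τ : SInf,
    σ = c * τ ∧ (c : Perm ℕ).IsCycle ∧ (c : Perm ℕ).Disjoint τ ∧
      {n | (τ : Perm ℕ) n ≠ n}.ncard < {n | (σ : Perm ℕ) n ≠ n}.ncard := by
  classical
  obtain ⟨x, hx⟩ : ∃ x, (σ : Perm ℕ) x ≠ x := by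
    by_contra! h
    exact hσ (Subtype.ext (Equiv.ext h))
  set c := (σ : Perm ℕ).cycleOf x with hc
  have hcyc : c.IsCycle := isCycle_cycleOf _ hx
  have hag : ∀ n, c n = n ∨ c n = (σ : Perm ℕ) n := fun n => by
    by_cases h : (σ : Perm ℕ).SameCycle x n
    · exact Or.inr h.cycleOf_apply
    · exact Or.inl (cycleOf_apply_of_not_sameCycle h)
  have hcmem : c ∈ SInf := by
    refine Set.Finite.subset σ.2 fun n hn hn' => ?_
    rcases hag n with h | h
    · exact hn h
    · exact hn (h.trans hn')
  have hdis : c.Disjoint (c⁻¹ * σ) := fun n => by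
    rcases hag n with h | h
    · exact Or.inl h
    · right
      rw [Perm.mul_apply, ← h, Perm.inv_eq_iff_eq]
  refine ⟨⟨c, hcmem⟩, ⟨c, hcmem⟩⁻¹ * σ, by simp, hcyc, hdis, ?_⟩
  refine Set.ncard_lt_ncard ?_ σ.2
  rw [Set.ssubset_iff_of_subset]
  · refine ⟨x, hx, ?_⟩
    have : c x = (σ : Perm ℕ) x := cycleOf_apply_self _ _
    simp [← this]
  · intro n hn hn'
    apply hn
    have hcn : c n = n := (hdis n).elim id fun h => absurd h hn
    change c⁻¹ ((σ : Perm ℕ) n) = n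
    rw [hn', Perm.inv_eq_iff_eq, hcn]

/-- Multiplying by a disjoint cycle of length `r` adds one to the number of `r`-cycles. -/
theorem cycleCount_cycle_mul {c τ : SInf} (hc : (c : Perm ℕ).IsCycle)
    (h : (c : Perm ℕ).Disjoint τ) (k : ℕ) :
    cycleCount k (c * τ) =
      cycleCount k τ + if {n | (c : Perm ℕ) n ≠ n}.ncard = k then 1 else 0 := by
  have hcag : ∀ n, (c : Perm ℕ) n ≠ n → (c : Perm ℕ) n = ((c * τ : SInf) : Perm ℕ) n := by
    intro n hn
    have : (τ : Perm ℕ) n = n := (h n).resolve_left hn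
    change _ = (c : Perm ℕ) ((τ : Perm ℕ) n)
    rw [this]
  have hτag : ∀ n, (τ : Perm ℕ) n ≠ n → (τ : Perm ℕ) n = ((c * τ : SInf) : Perm ℕ) n := by
    intro n hn
    have h' : (c : Perm ℕ) n = n := (h n).resolve_right hn
    have : ((c * τ : SInf) : Perm ℕ) n = ((τ : Perm ℕ) * (c : Perm ℕ)) n := by
      rw [← h.commute.eq]; rfl
    rw [this, Perm.mul_apply, h']
  have hset : ∀ d : Perm ℕ, (d.IsCycle ∧ ∀ n, d n ≠ n → d n = ((c * τ : SInf) : Perm ℕ) n) ↔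
      (d = c ∨ (d.IsCycle ∧ ∀ n, d n ≠ n → d n = (τ : Perm ℕ) n)) := by
    intro d
    constructor
    · rintro ⟨hd, hdσ⟩
      by_cases hx : ∃ x, d x ≠ x ∧ (c : Perm ℕ) x ≠ x
      · obtain ⟨x, h1, h2⟩ := hx
        exact Or.inl (cycle_eq_of_agree hd hc hdσ hcag h1 h2)
      · push Not at hx
        refine Or.inr ⟨hd, fun n hn => ?_⟩
        have h2 := hdσ n hn
        have h3 : ((c * τ : SInf) : Perm ℕ) n = ((τ : Perm ℕ) * (c : Perm ℕ)) n := by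
          rw [← h.commute.eq]; rfl
        rw [h2, h3, Perm.mul_apply, hx n hn]
    · rintro (rfl | ⟨hd, hdτ⟩)
      · exact ⟨hc, hcag⟩
      · refine ⟨hd, fun n hn => ?_⟩
        rw [hdτ n hn]
        exact hτag n (by rw [← hdτ n hn]; exact hn)
  have hnot : ¬ ((c : Perm ℕ).IsCycle ∧
      ∀ n, (c : Perm ℕ) n ≠ n → (c : Perm ℕ) n = (τ : Perm ℕ) n) := by
    rintro ⟨-, h'⟩
    obtain ⟨x, hx, -⟩ := hc
    exact hx ((h' x hx).trans ((h x).resolve_left hx))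
  have hfin : {d : Perm ℕ | d.IsCycle ∧ (∀ n, d n ≠ n → d n = (τ : Perm ℕ) n) ∧
      {n | d n ≠ n}.ncard = k}.Finite := by
    -- a cycle of `τ` is determined by any of the finitely many points that it moves
    choose! p hp using fun (d : Perm ℕ) (hd : d.IsCycle) => (show ∃ x, d x ≠ x from
      let ⟨x, hx, _⟩ := hd; ⟨x, hx⟩)
    refine Set.Finite.of_finite_image (f := p) (τ.2.subset ?_) ?_
    · rintro _ ⟨d, ⟨hd, hdτ, -⟩, rfl⟩
      change _ ≠ _
      rw [← hdτ _ (hp d hd)]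
      exact hp d hd
    · rintro d ⟨hd, hdτ, -⟩ d' ⟨hd', hdτ', -⟩ hdd
      exact cycle_eq_of_agree hd hd' hdτ hdτ' (hp d hd) (hdd ▸ hp d' hd')
  unfold cycleCount
  split_ifs with hk
  · rw [← Set.ncard_insert_of_notMem (a := (c : Perm ℕ)) (fun hmem => hnot ⟨hmem.1, hmem.2.1⟩) hfin]
    congr 1
    ext d
    have := hset d
    simp only [Set.mem_ofPred_eq, Set.mem_insert_iff, ← and_assoc, this]
    constructor
    · rintro ⟨rfl | h1, h2⟩
      · exact Or.inl rfl
      · exact Or.inr ⟨h1, h2⟩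
    · rintro (rfl | ⟨h1, h2⟩)
      · exact ⟨Or.inl rfl, hk⟩
      · exact ⟨Or.inr h1, h2⟩
  · rw [add_zero]
    congr 1
    ext d
    have := hset d
    simp only [Set.mem_ofPred_eq, ← and_assoc, this]
    constructor
    · rintro ⟨rfl | h1, h2⟩
      · exact absurd h2 hk
      · exact ⟨h1, h2⟩
    · rintro ⟨h1, h2⟩
      exact ⟨Or.inr h1, h2⟩

theorem cycleCount_one (k : ℕ) : cycleCount k 1 = 0 := by
  unfold cycleCount
  convert Set.ncard_empty (Perm ℕ)
  ext d
  simp only [Set.mem_ofPred_eq, Set.mem_empty_iff_false, iff_false]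
  rintro ⟨⟨x, hx, -⟩, h, -⟩
  exact hx (h x hx)

theorem two_le_ncard_of_isCycle {c : SInf} (hc : (c : Perm ℕ).IsCycle) :
    2 ≤ {n | (c : Perm ℕ) n ≠ n}.ncard := by
  obtain ⟨x, hx, -⟩ := hc
  have : 1 < {n | (c : Perm ℕ) n ≠ n}.ncard :=
    (Set.one_lt_ncard_iff c.2).2 ⟨x, (c : Perm ℕ) x, hx, fun h => hx ((c : Perm ℕ).injective h),
      hx.symm⟩
  omega

/-- A function on `S_∞` that is multiplicative over disjoint products is determined by its values
on cycles. -/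
theorem eq_finprod_of_disjoint_mul {M : Type*} [CommMonoid M] (F : SInf → M) (f : ℕ → M)
    (h1 : F 1 = 1)
    (hmul : ∀ σ τ : SInf, (σ : Perm ℕ).Disjoint τ → F (σ * τ) = F σ * F τ)
    (hcyc : ∀ c : SInf, (c : Perm ℕ).IsCycle → F c = f {n | (c : Perm ℕ) n ≠ n}.ncard)
    (σ : SInf) : F σ = ∏ᶠ (k : ℕ) (_ : 2 ≤ k), f k ^ cycleCount k σ := by
  induction hN : {n | (σ : Perm ℕ) n ≠ n}.ncard using Nat.strong_induction_on generalizing σ with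
  | _ N ih =>
  by_cases hσ : σ = 1
  · subst hσ
    simp [cycleCount_one, h1]
  obtain ⟨c, τ, rfl, hc, hdis, hlt⟩ := exists_cycle_mul σ hσ
  rw [hmul c τ hdis, ih _ (hN ▸ hlt) τ rfl, hcyc c hc]
  set r := {n | (c : Perm ℕ) n ≠ n}.ncard with hr
  have hr2 : 2 ≤ r := two_le_ncard_of_isCycle hc
  have hsplit : ∀ k, (∏ᶠ (_ : 2 ≤ k), f k ^ cycleCount k (c * τ)) =
      (if k = r then f r else 1) * ∏ᶠ (_ : 2 ≤ k), f k ^ cycleCount k τ := by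
    intro k
    rw [cycleCount_cycle_mul hc hdis, ← hr]
    by_cases hk : k = r
    · subst hk
      simp [hr2, pow_succ, mul_comm]
    · rw [if_neg hk, if_neg (Ne.symm hk), one_mul, add_zero]
  rw [finprod_congr hsplit, finprod_mul_distrib,
    finprod_eq_single (fun k => if k = r then f r else 1) r, if_pos rfl]
  · intro k hk
    rw [if_neg hk]
  · refine (Set.finite_singleton r).subset fun k hk => ?_
    by_contra h
    exact hk (if_neg h)
  · refine (finite_cycleCount τ).subset fun k hk h => hk ?_
    simp [h]

/-- A cycle that moves `0` is a product of star generators with distinct indices. -/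
theorem exists_starGen_prod (c : SInf) (hc : (c : Perm ℕ).IsCycle) (h0 : (c : Perm ℕ) 0 ≠ 0) :
    ∃ l : List ℕ, l.Nodup ∧ 0 ∉ l ∧ c = (l.map starGen).prod ∧
      {n | (c : Perm ℕ) n ≠ n}.ncard = l.length + 1 := by
  suffices H : ∀ N, ∀ c : SInf, (c : Perm ℕ).IsCycle → (c : Perm ℕ) 0 ≠ 0 →
      {n | (c : Perm ℕ) n ≠ n}.ncard = N → ∃ l : List ℕ, l.Nodup ∧ 0 ∉ l ∧
      (∀ i ∈ l, (c : Perm ℕ) i ≠ i) ∧ c = (l.map starGen).prod ∧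
      {n | (c : Perm ℕ) n ≠ n}.ncard = l.length + 1 by
    obtain ⟨l, h1, h2, -, h3⟩ := H _ c hc h0 rfl
    exact ⟨l, h1, h2, h3⟩
  intro N
  induction N with
  | zero =>
    intro c hc _ hN
    have := two_le_ncard_of_isCycle hc
    omega
  | succ N ih =>
    intro c hc h0 hN
    set i := (c : Perm ℕ) 0 with hi
    have hci : (c : Perm ℕ) i ≠ i := fun h => h0 ((c : Perm ℕ).injective h)
    by_cases hci0 : (c : Perm ℕ) i = 0
    · have hsw : (c : Perm ℕ) = swap 0 i := hc.eq_swap_of_apply_apply_eq_self h0 hci0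
      refine ⟨[i], by simp, by simpa using h0.symm, by simpa using hci, ?_, ?_⟩
      · simpa [starGen] using Subtype.ext hsw
      · have : {n | (c : Perm ℕ) n ≠ n} = {0, i} := by
          ext n
          rw [Set.mem_ofPred_eq, hsw, swap_apply_ne_self_iff]
          simp [Ne.symm h0]
        rw [this, Set.ncard_pair (Ne.symm h0)]
        rfl
    · -- `c * (0, i)` is the cycle `c` with the point `i = c 0` removed
      have hs : (starGen i : Perm ℕ) = swap 0 i := rfl
      have hss : starGen i * starGen i = 1 := Subtype.ext (by
        change swap 0 i * swap 0 i = 1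
        exact swap_mul_self _ _)
      have hcoe : ((c * starGen i : SInf) : Perm ℕ) = (c : Perm ℕ) * swap 0 i := rfl
      have hcyc : ((c * starGen i : SInf) : Perm ℕ).IsCycle := by
        have h1 := (hc.swap_mul h0 hci0).conj (g := swap 0 i)
        rwa [swap_inv, ← mul_assoc, ← hi, swap_mul_self, one_mul] at h1
      have hval0 : ((c * starGen i : SInf) : Perm ℕ) 0 = (c : Perm ℕ) i := by
        rw [hcoe, Perm.mul_apply, swap_apply_left]
      have hvali : ((c * starGen i : SInf) : Perm ℕ) i = i := by
        rw [hcoe, Perm.mul_apply, swap_apply_right]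
      have hval : ∀ n, n ≠ 0 → n ≠ i → ((c * starGen i : SInf) : Perm ℕ) n = (c : Perm ℕ) n := by
        intro n h1 h2
        rw [hcoe, Perm.mul_apply, swap_apply_of_ne_of_ne h1 h2]
      have hsupp : {n | (c : Perm ℕ) n ≠ n} =
          insert i {n | ((c * starGen i : SInf) : Perm ℕ) n ≠ n} := by
        ext n
        simp only [Set.mem_ofPred_eq, Set.mem_insert_iff]
        by_cases hn0 : n = 0
        · subst hn0
          rw [hval0]
          exact iff_of_true h0 (Or.inr hci0)
        by_cases hni : n = i
        · rw [hni]
          exact iff_of_true hci (Or.inl rfl)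
        rw [hval n hn0 hni]
        exact ⟨Or.inr, fun h => h.resolve_left hni⟩
      have hcard : {n | (c : Perm ℕ) n ≠ n}.ncard =
          {n | ((c * starGen i : SInf) : Perm ℕ) n ≠ n}.ncard + 1 := by
        rw [hsupp]
        exact Set.ncard_insert_of_notMem (fun h => h hvali) (c * starGen i).2
      obtain ⟨l, hl1, hl2, hl3, hl4, hl5⟩ := ih (c * starGen i) hcyc (by rwa [hval0]) (by omega)
      have hil : i ∉ l := fun h => hl3 i h hvali
      refine ⟨l ++ [i], ?_, ?_, ?_, ?_, ?_⟩
      · rw [List.nodup_append]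
        refine ⟨hl1, by simp, ?_⟩
        intro a ha b hb
        rw [List.mem_singleton] at hb
        rw [hb]
        exact fun h => hil (h ▸ ha)
      · simp only [List.mem_append, List.mem_singleton, not_or]
        exact ⟨hl2, Ne.symm h0⟩
      · intro a ha
        rw [List.mem_append, List.mem_singleton] at ha
        have : a ∈ {n | (c : Perm ℕ) n ≠ n} := by
          rw [hsupp]
          rcases ha with ha | ha
          · exact Or.inr (hl3 a ha)
          · exact Or.inl ha
        exact this
      · rw [List.map_append, List.prod_append, ← hl4, List.map_singleton, List.prod_singleton,
          mul_assoc, hss, mul_one]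
      · rw [hcard, hl5, List.length_append, List.length_singleton]

/-- A finite set can be moved beyond any given bound by a finite permutation that fixes the other
points below this bound. -/
theorem exists_move {S : Set ℕ} (hS : S.Finite) (N : ℕ) :
    ∃ g : SInf, (∀ i ∈ S, N ≤ (g : Perm ℕ) i) ∧ ∀ i ∉ S, i < N → (g : Perm ℕ) i = i := by
  classical
  obtain ⟨B, hB⟩ := hS.bddAbove
  -- the involution exchanging `i` and `i + M` for `i ∈ S`
  set M := N + B + 1 with hM
  have hSM : ∀ i, i ∈ S → i < M := fun i hi => by
    have := hB hi
    omega
  let f : ℕ → ℕ := fun i => if i ∈ S then i + M else if M ≤ i ∧ i - M ∈ S then i - M else i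
  have hf : Function.Involutive f := by
    intro i
    by_cases hi : i ∈ S
    · have h1 : i + M ∉ S := fun h => by
        have := hSM _ h
        omega
      simp [f, hi, h1]
    · by_cases hi' : M ≤ i ∧ i - M ∈ S
      · simp only [f, hi, hi', if_false, if_true, and_self]
        omega
      · simp only [f, hi, hi', if_false]
  refine ⟨⟨hf.toPerm f, ?_⟩, ?_, ?_⟩
  · refine (hS.union (hS.image (· + M))).subset fun i hi => ?_
    by_contra h
    simp only [Set.mem_union, not_or] at h
    refine hi ?_
    change f i = i
    have : ¬ (M ≤ i ∧ i - M ∈ S) := fun ⟨h1, h2⟩ => h.2 ⟨i - M, h2, by simp; omega⟩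
    simp [f, h.1, this]
  · intro i hi
    change N ≤ f i
    simp only [f, hi, if_true]
    omega
  · intro i hi hiN
    change f i = i
    have : ¬ (M ≤ i ∧ i - M ∈ S) := fun h => by omega
    simp [f, hi, this]

theorem swap_mem_tail_two {i j : ℕ} (hi : i ≠ 0) (hj : j ≠ 0) :
    (⟨swap i j, swap_mem i j⟩ : SInf) ∈ tail 2 := by
  set K : Subgroup (Perm ℕ) := (tail 2).map SInf.subtype with hK
  have hadj : ∀ n : ℕ, n ≠ 0 → swap n (n + 1) ∈ K := fun n hn =>
    ⟨coxeter (n + 1), Subgroup.subset_closure ⟨n + 1, by omega, rfl⟩, by simp [coxeter]⟩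
  have hadd : ∀ d n : ℕ, n ≠ 0 → swap n (n + d) ∈ K := by
    intro d n hn
    induction d with
    | zero =>
      rw [add_zero, swap_self]
      exact K.one_mem
    | succ d ih => exact SubmonoidClass.swap_mem_trans K ih (hadj (n + d) (by omega))
  have hall : swap i j ∈ K := by
    rcases le_total i j with h | h
    · obtain ⟨d, rfl⟩ := Nat.exists_eq_add_of_le h
      exact hadd d i hi
    · obtain ⟨d, rfl⟩ := Nat.exists_eq_add_of_le h
      rw [swap_comm]
      exact hadd d j hj
  obtain ⟨g, hg, hgf⟩ := hall
  exact (Subtype.ext hgf : g = ⟨swap i j, swap_mem i j⟩) ▸ hg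

theorem apply_zero_of_mem_tail_two {g : SInf} (hg : g ∈ tail 2) : (g : Perm ℕ) 0 = 0 := by
  have hle : tail 2 ≤ (MulAction.stabilizer (Perm ℕ) (0 : ℕ)).comap SInf.subtype := by
    rw [tail, Subgroup.closure_le]
    rintro _ ⟨i, hi, rfl⟩
    change swap (i - 1) i 0 = 0
    exact swap_apply_of_ne_of_ne (by omega) (by omega)
  exact hle hg

end SInf

/-! ### Trace-preserving conditional expectations -/

namespace VonNeumannAlgebra

variable {H : Type*} [NormedAddCommGroup H] [InnerProductSpace ℂ H] [CompleteSpace H]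
variable {M N : VonNeumannAlgebra H} {hNM : N.toStarSubalgebra ≤ M.toStarSubalgebra}
  {tr : M.Elem →ₗ[ℂ] ℂ} {E : M.Elem →ₗ[ℂ] N.Elem}

theorem IsCondExp.trace_mul (hE : IsCondExp hNM tr E) (w : N.Elem) (x : M.Elem) :
    tr (StarSubalgebra.inclusion hNM w * StarSubalgebra.inclusion hNM (E x)) =
      tr (StarSubalgebra.inclusion hNM w * x) := by
  have h := hE.bimodule w 1 x
  rw [map_one, mul_one, mul_one] at h
  rw [← hE.preserves (_ * x), h, map_mul (StarSubalgebra.inclusion hNM)]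

/-- `E x` is determined by the trace pairings of `x` with the subalgebra, because the trace is
faithful. -/
theorem IsCondExp.eq_of_trace_mul (htr : M.IsFaithfulNormalTracialState tr)
    (hE : IsCondExp hNM tr E) {x : M.Elem} {y : N.Elem}
    (h : ∀ w : N.Elem, tr (StarSubalgebra.inclusion hNM w * StarSubalgebra.inclusion hNM y) =
      tr (StarSubalgebra.inclusion hNM w * x)) : E x = y := by
  have h0 : StarSubalgebra.inclusion hNM (E x - y) = 0 := by
    apply htr.faithful
    rw [← map_star, map_sub (StarSubalgebra.inclusion hNM) (E x) y, mul_sub, map_sub,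
      hE.trace_mul, h, sub_self]
  exact sub_eq_zero.1 (Subtype.ext (congrArg (fun z : M.Elem => (z : H →L[ℂ] H)) h0))

theorem IsCondExp.unique (htr : M.IsFaithfulNormalTracialState tr) {E' : M.Elem →ₗ[ℂ] N.Elem}
    (hE : IsCondExp hNM tr E) (hE' : IsCondExp hNM tr E') : E = E' :=
  LinearMap.ext fun x => hE.eq_of_trace_mul htr fun w => hE'.trace_mul w x

end VonNeumannAlgebra

/-! ### Averages over finite groups of permutations -/

namespace SInf

open VonNeumannAlgebra

/-- The finite subgroup of the permutations that fix all points `n ≥ N`. -/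
def initial (N : ℕ) : Subgroup SInf where
  carrier := {σ | ∀ n, N ≤ n → (σ : Equiv.Perm ℕ) n = n}
  one_mem' := fun _ _ => rfl
  mul_mem' := fun {σ τ} hσ hτ n hn => by
    change (σ : Equiv.Perm ℕ) ((τ : Equiv.Perm ℕ) n) = n
    rw [hτ n hn, hσ n hn]
  inv_mem' := fun {σ} hσ n hn => by
    change (σ : Equiv.Perm ℕ)⁻¹ n = n
    rw [Equiv.Perm.inv_eq_iff_eq, hσ n hn]

instance finite_initial (N : ℕ) : Finite (initial N) := by
  have hlt : ∀ (σ : initial N) (i : Fin N), ((σ : SInf) : Equiv.Perm ℕ) i < N := by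
    intro σ i
    by_contra! h
    have h1 := ((σ : SInf) : Equiv.Perm ℕ).injective (σ.2 _ h)
    exact absurd i.2 (not_lt.2 (h1 ▸ h))
  refine Finite.of_injective
    (fun (σ : initial N) (i : Fin N) => (⟨((σ : SInf) : Equiv.Perm ℕ) i, hlt σ i⟩ : Fin N)) ?_
  intro σ τ h
  refine Subtype.ext (Subtype.ext (Equiv.ext fun n => ?_))
  by_cases hn : n < N
  · exact congrArg Fin.val (congrFun h ⟨n, hn⟩)
  · rw [σ.2 n (not_lt.1 hn), τ.2 n (not_lt.1 hn)]

theorem eventually_mem_initial (g : SInf) : ∀ᶠ N in atTop, g ∈ initial N := by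
  obtain ⟨B, hB⟩ := Set.Finite.bddAbove (show {n | (g : Equiv.Perm ℕ) n ≠ n}.Finite from g.2)
  filter_upwards [eventually_gt_atTop B] with N hN n hn
  by_contra h
  exact absurd (hB h) (by omega)

instance finite_inf_initial (G : Subgroup SInf) (N : ℕ) : Finite ↥(G ⊓ initial N) :=
  Finite.of_injective (Subgroup.inclusion (inf_le_right : G ⊓ initial N ≤ initial N))
    (Subgroup.inclusion_injective _)

variable {H : Type*} [NormedAddCommGroup H] [InnerProductSpace ℂ H] [CompleteSpace H]
variable (π : SInf →* unitary (H →L[ℂ] H))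

theorem rep_mul (g h : SInf) : rep π (g * h) = rep π g * rep π h :=
  Subtype.ext (by simp [rep])

theorem rep_one : rep π 1 = 1 := Subtype.ext (by simp [rep])

theorem rep_inv_mul (g : SInf) : rep π g⁻¹ * rep π g = 1 := by
  rw [← rep_mul, inv_mul_cancel, rep_one]

theorem rep_mul_inv (g : SInf) : rep π g * rep π g⁻¹ = 1 := by
  rw [← rep_mul, mul_inv_cancel, rep_one]

theorem star_rep (g : SInf) : star (rep π g) = rep π g⁻¹ :=
  Subtype.ext (by
    change star (π g : H →L[ℂ] H) = (π g⁻¹ : unitary (H →L[ℂ] H))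
    rw [map_inv]
    rfl)

theorem norm_rep_le (g : SInf) : ‖(rep π g : H →L[ℂ] H)‖ ≤ ‖(1 : H →L[ℂ] H)‖ := by
  have h := CStarRing.norm_coe_unitary_mul (π g) (1 : H →L[ℂ] H)
  rw [mul_one] at h
  exact h.le

theorem norm_rep_conj (g : SInf) (x : (repAlgebra π).Elem) :
    ‖((rep π g * x * rep π g⁻¹ : (repAlgebra π).Elem) : H →L[ℂ] H)‖ = ‖(x : H →L[ℂ] H)‖ := by
  change ‖(π g : H →L[ℂ] H) * (x : H →L[ℂ] H) * (π g⁻¹ : H →L[ℂ] H)‖ = _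
  rw [CStarRing.norm_mul_coe_unitary, CStarRing.norm_coe_unitary_mul]

theorem trace_rep_conj {tr : (repAlgebra π).Elem →ₗ[ℂ] ℂ}
    (htr : (repAlgebra π).IsFaithfulNormalTracialState tr) (g : SInf) (x : (repAlgebra π).Elem) :
    tr (rep π g * x * rep π g⁻¹) = tr x := by
  rw [htr.tracial, ← mul_assoc, rep_inv_mul, one_mul]

theorem rep_mul_fixed {G : Subgroup SInf} {g : SInf} (hg : g ∈ G) (y : (fixedPoints π G).Elem) :
    rep π g * StarSubalgebra.inclusion (fixedPoints_le π G) y =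
      StarSubalgebra.inclusion (fixedPoints_le π G) y * rep π g :=
  Subtype.ext ((rep_conj_iff π g _).1 (y.2.2 g hg))

/-- The average of the elements `π(g) x π(g)*` over a finite group of permutations `g`. -/
noncomputable def average (K : Subgroup SInf) [Fintype K] (x : (repAlgebra π).Elem) :
    (repAlgebra π).Elem :=
  (Fintype.card K : ℂ)⁻¹ • ∑ g : K, rep π g * x * rep π (g : SInf)⁻¹

section average

variable (K : Subgroup SInf) [Fintype K]

theorem average_add (x y : (repAlgebra π).Elem) :
    average π K (x + y) = average π K x + average π K y := by
  simp only [average, mul_add, add_mul, Finset.sum_add_distrib, smul_add]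

theorem average_smul (c : ℂ) (x : (repAlgebra π).Elem) :
    average π K (c • x) = c • average π K x := by
  simp only [average, mul_smul_comm, smul_mul_assoc, ← Finset.smul_sum]
  rw [smul_comm]

theorem rep_mul_average {h : SInf} (hh : h ∈ K) (x : (repAlgebra π).Elem) :
    rep π h * average π K x = average π K x * rep π h := by
  simp only [average, mul_smul_comm, smul_mul_assoc, Finset.mul_sum, Finset.sum_mul]
  congr 1
  refine Fintype.sum_equiv (Equiv.mulLeft (⟨h, hh⟩ : K)) _ _ fun g => ?_
  simp only [Equiv.coe_mulLeft, Subgroup.coe_mul, mul_inv_rev, rep_mul, mul_assoc, rep_inv_mul,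
    mul_one]

theorem average_fixed_mul_mul_fixed {G : Subgroup SInf} (hK : K ≤ G)
    (y z : (fixedPoints π G).Elem) (x : (repAlgebra π).Elem) :
    average π K (StarSubalgebra.inclusion (fixedPoints_le π G) y * x *
        StarSubalgebra.inclusion (fixedPoints_le π G) z) =
      StarSubalgebra.inclusion (fixedPoints_le π G) y * average π K x *
        StarSubalgebra.inclusion (fixedPoints_le π G) z := by
  simp only [average, mul_smul_comm, smul_mul_assoc, Finset.mul_sum, Finset.sum_mul]
  congr 1
  refine Finset.sum_congr rfl fun g _ => ?_
  have hy := rep_mul_fixed π (hK g.2) y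
  have hz := rep_mul_fixed π (inv_mem (hK g.2)) z
  simp only [mul_assoc]
  rw [← hz, ← mul_assoc, hy, mul_assoc]

theorem average_fixed {G : Subgroup SInf} (hK : K ≤ G) (y : (fixedPoints π G).Elem) :
    average π K (StarSubalgebra.inclusion (fixedPoints_le π G) y) =
      StarSubalgebra.inclusion (fixedPoints_le π G) y := by
  have h : ∀ g : K, rep π g * StarSubalgebra.inclusion (fixedPoints_le π G) y *
      rep π (g : SInf)⁻¹ = StarSubalgebra.inclusion (fixedPoints_le π G) y := fun g => by
    rw [rep_mul_fixed π (hK g.2), mul_assoc, rep_mul_inv, mul_one]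
  simp only [average, h, Finset.sum_const, Finset.card_univ, ← Nat.cast_smul_eq_nsmul ℂ]
  rw [smul_smul, inv_mul_cancel₀ (Nat.cast_ne_zero.2 Fintype.card_ne_zero), one_smul]

theorem trace_average {tr : (repAlgebra π).Elem →ₗ[ℂ] ℂ}
    (htr : (repAlgebra π).IsFaithfulNormalTracialState tr) (x : (repAlgebra π).Elem) :
    tr (average π K x) = tr x := by
  simp only [average, map_smul, map_sum, trace_rep_conj π htr, Finset.sum_const,
    Finset.card_univ, nsmul_eq_mul, smul_eq_mul]
  rw [← mul_assoc, inv_mul_cancel₀ (Nat.cast_ne_zero.2 Fintype.card_ne_zero), one_mul]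

theorem norm_average_le (x : (repAlgebra π).Elem) :
    ‖(average π K x : H →L[ℂ] H)‖ ≤ ‖(x : H →L[ℂ] H)‖ := by
  have hcoe : (average π K x : H →L[ℂ] H) = (Fintype.card K : ℂ)⁻¹ •
      ∑ g : K, ((rep π g * x * rep π (g : SInf)⁻¹ : (repAlgebra π).Elem) : H →L[ℂ] H) := by
    rw [average, ← AddSubmonoidClass.coe_finsetSum]
    rfl
  rw [hcoe, norm_smul, norm_inv, Complex.norm_natCast,
    inv_mul_le_iff₀ (Nat.cast_pos.2 Fintype.card_pos)]
  refine (norm_sum_le _ _).trans ?_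
  simp only [norm_rep_conj, Finset.sum_const, Finset.card_univ, nsmul_eq_mul, le_refl]

open scoped ComplexOrder in
theorem isPositive_average_star_mul_self (x : (repAlgebra π).Elem) :
    (average π K (star x * x) : H →L[ℂ] H).IsPositive := by
  have hcoe : (average π K (star x * x) : H →L[ℂ] H) = (Fintype.card K : ℂ)⁻¹ •
      ∑ g : K, star ((x * rep π (g : SInf)⁻¹ : (repAlgebra π).Elem) : H →L[ℂ] H) *
        ((x * rep π (g : SInf)⁻¹ : (repAlgebra π).Elem) : H →L[ℂ] H) := by
    have h : ∀ g : K, rep π g * (star x * x) * rep π (g : SInf)⁻¹ =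
        star (x * rep π (g : SInf)⁻¹) * (x * rep π (g : SInf)⁻¹) := fun g => by
      rw [star_mul, star_rep, inv_inv]
      simp only [mul_assoc]
    simp only [average, h]
    change (Fintype.card K : ℂ)⁻¹ • ((∑ g : K, star (x * rep π (g : SInf)⁻¹) *
      (x * rep π (g : SInf)⁻¹) : (repAlgebra π).Elem) : H →L[ℂ] H) = _
    rw [AddSubmonoidClass.coe_finsetSum]
    rfl
  rw [hcoe, ← ContinuousLinearMap.nonneg_iff_isPositive]
  refine smul_nonneg ?_ (Finset.sum_nonneg fun g _ => star_mul_self_nonneg _)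
  rw [← Complex.ofReal_natCast, ← Complex.ofReal_inv, Complex.zero_le_real]
  positivity

end average

/-- The conditional expectation onto the fixed points of `G` is a weak operator limit of the
averages over an exhausting sequence of finite subgroups of `G`. Working along one fixed ultrafilter
makes the limit linear, and normality of the trace makes it trace preserving. -/
theorem exists_isCondExp {tr : (repAlgebra π).Elem →ₗ[ℂ] ℂ}
    (htr : (repAlgebra π).IsFaithfulNormalTracialState tr) (G : Subgroup SInf) :
    ∃ E : (repAlgebra π).Elem →ₗ[ℂ] (fixedPoints π G).Elem,
      IsCondExp (fixedPoints_le π G) tr E := by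
  have : ∀ N, Fintype ↥(G ⊓ initial N) := fun N => Fintype.ofFinite _
  have hlim : ∀ x : (repAlgebra π).Elem, ∃ y : H →L[ℂ] H,
      WeakTendsto (fun N => (average π (G ⊓ initial N) x : H →L[ℂ] H)) (hyperfilter ℕ) y :=
    fun x => exists_weakTendsto _ _ _ fun N => norm_average_le π _ x
  choose L hL using hlim
  have hmem : ∀ x, L x ∈ (repAlgebra π).toStarSubalgebra := fun x =>
    (hL x).mem _ fun N => (average π (G ⊓ initial N) x).2
  have hfix : ∀ x, L x ∈ (fixedPoints π G).toStarSubalgebra := fun x =>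
    ⟨hmem x, fun g hg => (rep_conj_iff π g _).2 ((hL x).commute
      (((eventually_mem_initial g).filter_mono Nat.hyperfilter_le_atTop).mono fun N hN =>
        congrArg Subtype.val (rep_mul_average π (G ⊓ initial N) ⟨hg, hN⟩ x)))⟩
  refine ⟨{ toFun := fun x => ⟨L x, hfix x⟩
            map_add' := fun x y => Subtype.ext ((hL (x + y)).unique
              (((hL x).add (hL y)).congr' (Eventually.of_forall fun N =>
                (congrArg Subtype.val (average_add π (G ⊓ initial N) x y)).symm)))
            map_smul' := fun c x => Subtype.ext ((hL (c • x)).unique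
              (((hL x).smul c).congr' (Eventually.of_forall fun N =>
                (congrArg Subtype.val (average_smul π (G ⊓ initial N) c x)).symm))) },
    ?_, ?_, ?_, ?_⟩
  · intro y
    exact Subtype.ext ((hL _).unique ((WeakTendsto.const _).congr' (Eventually.of_forall fun N =>
      (congrArg Subtype.val (average_fixed π (G ⊓ initial N) inf_le_left y)).symm)))
  · intro y z x
    exact Subtype.ext ((hL _).unique ((((hL x).mul_left y).mul_right z).congr'
      (Eventually.of_forall fun N => (congrArg Subtype.val
        (average_fixed_mul_mul_fixed π (G ⊓ initial N) inf_le_left y z x)).symm)))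
  · intro x
    exact (hL _).isPositive fun N => isPositive_average_star_mul_self π _ x
  · intro x
    refine tendsto_nhds_unique (htr.normal.tendsto (y := ⟨L x, hmem x⟩)
      (fun N => norm_average_le π (G ⊓ initial N) x) (hL x)) ?_
    simp only [trace_average π _ htr]
    exact tendsto_const_nhds

end SInf

/-! ### Limits of conjugates and multiplicativity -/

namespace SInf

open VonNeumannAlgebra

variable {H : Type*} [NormedAddCommGroup H] [InnerProductSpace ℂ H] [CompleteSpace H]
variable (π : SInf →* unitary (H →L[ℂ] H))

/-- A sequence `π(s_N)` is bounded, so it has a weak operator limit along an ultrafilter. The limit is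
fixed by every `h` that commutes with all but finitely many of the `s_N`. -/
theorem exists_weakTendsto_rep (G : Subgroup SInf) (s : ℕ → SInf)
    (hs : ∀ h ∈ G, ∀ᶠ N in atTop, Commute h (s N)) :
    ∃ y : (fixedPoints π G).Elem,
      WeakTendsto (fun N => (rep π (s N) : H →L[ℂ] H)) (hyperfilter ℕ) (y : H →L[ℂ] H) := by
  obtain ⟨y, hy⟩ := exists_weakTendsto (hyperfilter ℕ) (fun N => (rep π (s N) : H →L[ℂ] H)) _
    fun N => norm_rep_le π (s N)
  refine ⟨⟨y, hy.mem _ fun N => (rep π (s N)).2, fun h hh => (rep_conj_iff π h y).2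
    (hy.commute (((hs h hh).filter_mono Nat.hyperfilter_le_atTop).mono fun N hN => ?_))⟩, hy⟩
  have h1 : rep π h * rep π (s N) = rep π (s N) * rep π h := by
    rw [← rep_mul, ← rep_mul, hN.eq]
  exact congrArg Subtype.val h1

variable {tr : (repAlgebra π).Elem →ₗ[ℂ] ℂ}

/-- If `π(s_N)` tends weakly to `y` and `tr (a π(s_N) b)` is eventually constant, then `y` realizes
the constant. -/
theorem trace_mul_weakLimit (htr : (repAlgebra π).IsFaithfulNormalTracialState tr)
    {s : ℕ → SInf} {y : (repAlgebra π).Elem}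
    (hy : WeakTendsto (fun N => (rep π (s N) : H →L[ℂ] H)) (hyperfilter ℕ) (y : H →L[ℂ] H))
    (a b : (repAlgebra π).Elem) {c : ℂ} (hc : ∀ᶠ N in atTop, tr (a * rep π (s N) * b) = c) :
    tr (a * y * b) = c :=
  tendsto_nhds_unique (htr.normal.tendsto_mul_mul (fun N => norm_rep_le π (s N)) hy a b)
    (tendsto_const_nhds.congr' ((hc.filter_mono Nat.hyperfilter_le_atTop).mono fun _ h => h.symm))

/-- Pushing the support of `σ` to infinity by conjugation produces a central weak limit `y`, which
may replace `π(σ)` in traces against a central element and a disjoint permutation. -/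
theorem exists_central_limit (htr : (repAlgebra π).IsFaithfulNormalTracialState tr) (σ : SInf) :
    ∃ y : (algNegOne π).Elem, ∀ (z : (algNegOne π).Elem) (τ : SInf),
      (σ : Equiv.Perm ℕ).Disjoint τ →
        tr (StarSubalgebra.inclusion (fixedPoints_le π (tail 1)) z *
            StarSubalgebra.inclusion (fixedPoints_le π (tail 1)) y * rep π τ) =
          tr (StarSubalgebra.inclusion (fixedPoints_le π (tail 1)) z * rep π σ * rep π τ) := by
  choose g hg hg' using exists_move (show {n | (σ : Equiv.Perm ℕ) n ≠ n}.Finite from σ.2)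
  have hcomm : ∀ h : SInf, ∀ᶠ N in atTop, Commute h (g N * σ * (g N)⁻¹) := by
    intro h
    filter_upwards [eventually_mem_initial h] with N hN
    have hdis : (h : Equiv.Perm ℕ).Disjoint ((g N * σ * (g N)⁻¹ : SInf) : Equiv.Perm ℕ) := by
      intro n
      by_cases hn : N ≤ n
      · exact Or.inl (hN n hn)
      right
      change (g N : Equiv.Perm ℕ) ((σ : Equiv.Perm ℕ) ((g N : Equiv.Perm ℕ)⁻¹ n)) = n
      have hfix : (σ : Equiv.Perm ℕ) ((g N : Equiv.Perm ℕ)⁻¹ n) = (g N : Equiv.Perm ℕ)⁻¹ n := by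
        by_contra hne
        have h1 := hg N _ hne
        rw [← Equiv.Perm.mul_apply, mul_inv_cancel, Equiv.Perm.one_apply] at h1
        exact hn h1
      rw [hfix, ← Equiv.Perm.mul_apply, mul_inv_cancel, Equiv.Perm.one_apply]
    exact Subtype.ext hdis.commute.eq
  obtain ⟨y, hy⟩ := exists_weakTendsto_rep π (tail 1) _ fun h _ => hcomm h
  refine ⟨y, fun z τ hdis => trace_mul_weakLimit π htr
    (y := StarSubalgebra.inclusion (fixedPoints_le π (tail 1)) y) hy _ _ ?_⟩
  filter_upwards [eventually_mem_initial τ] with N hN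
  have hgτ : rep π (g N) * rep π τ = rep π τ * rep π (g N) := by
    have hd : (g N : Equiv.Perm ℕ).Disjoint τ := by
      intro n
      by_cases hn : N ≤ n
      · exact Or.inr (hN n hn)
      rcases hdis n with h | h
      · exact Or.inl (hg' N n (fun h' => h' h) (not_le.1 hn))
      · exact Or.inr h
    rw [← rep_mul, ← rep_mul]
    exact congrArg (rep π) (Subtype.ext hd.commute.eq)
  have hz := rep_mul_fixed π (show g N ∈ tail 1 by rw [tail_one]; trivial) z
  rw [← trace_rep_conj π htr (g N)
    (StarSubalgebra.inclusion (fixedPoints_le π (tail 1)) z * rep π σ * rep π τ)]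
  congr 1
  have h1 : rep π τ * rep π (g N)⁻¹ = rep π (g N)⁻¹ * rep π τ := by
    calc rep π τ * rep π (g N)⁻¹
        = rep π (g N)⁻¹ * (rep π (g N) * rep π τ) * rep π (g N)⁻¹ := by
          rw [← mul_assoc, rep_inv_mul, one_mul]
      _ = rep π (g N)⁻¹ * rep π τ := by
          rw [hgτ, mul_assoc, mul_assoc, rep_mul_inv, mul_one]
  simp only [rep_mul, mul_assoc]
  rw [h1, ← mul_assoc (rep π (g N)) (StarSubalgebra.inclusion _ z), hz]
  simp only [mul_assoc]

variable {Em : (repAlgebra π).Elem →ₗ[ℂ] (algNegOne π).Elem}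
  {E₀ : (repAlgebra π).Elem →ₗ[ℂ] (algZero π).Elem}

theorem condExp_rep_mul_of_disjoint (htr : (repAlgebra π).IsFaithfulNormalTracialState tr)
    (hEm : IsCondExp (fixedPoints_le π (tail 1)) tr Em) {σ τ : SInf}
    (h : (σ : Equiv.Perm ℕ).Disjoint τ) :
    Em (rep π (σ * τ)) = Em (rep π σ) * Em (rep π τ) := by
  obtain ⟨y, hy⟩ := exists_central_limit π htr σ
  have hEσ : Em (rep π σ) = y := hEm.eq_of_trace_mul htr fun w => by
    have h1 := hy w 1 (Equiv.Perm.disjoint_one_right _)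
    rwa [rep_one, mul_one, mul_one] at h1
  refine hEm.eq_of_trace_mul htr fun w => ?_
  rw [map_mul (StarSubalgebra.inclusion (fixedPoints_le π (tail 1))), ← mul_assoc,
    ← map_mul (StarSubalgebra.inclusion (fixedPoints_le π (tail 1))), hEm.trace_mul, hEσ,
    map_mul (StarSubalgebra.inclusion (fixedPoints_le π (tail 1))), hy w τ h, rep_mul, mul_assoc]

theorem condExp_rep_conj (htr : (repAlgebra π).IsFaithfulNormalTracialState tr)
    (hEm : IsCondExp (fixedPoints_le π (tail 1)) tr Em) (g σ : SInf) :
    Em (rep π (g * σ * g⁻¹)) = Em (rep π σ) := by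
  refine hEm.eq_of_trace_mul htr fun w => ?_
  have hw := rep_mul_fixed π (show g ∈ tail 1 by rw [tail_one]; trivial) w
  rw [hEm.trace_mul, rep_mul, rep_mul, ← mul_assoc, ← mul_assoc, ← hw,
    mul_assoc (rep π g), trace_rep_conj π htr]

theorem conj_swap_starGen {i N : ℕ} (hi : i ≠ 0) (hN : N ≠ 0) :
    (⟨Equiv.swap i N, swap_mem i N⟩ : SInf) * starGen i =
      starGen N * ⟨Equiv.swap i N, swap_mem i N⟩ := by
  refine Subtype.ext ?_
  change Equiv.swap i N * Equiv.swap 0 i = Equiv.swap 0 N * Equiv.swap i N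
  rw [Equiv.mul_swap_eq_swap_mul, Equiv.swap_apply_left,
    Equiv.swap_apply_of_ne_of_ne hi.symm hN.symm]

theorem swap_commute_starGen {i j N : ℕ} (hi : i ≠ 0) (hN : N ≠ 0) (hji : j ≠ i) (hjN : j ≠ N) :
    Commute (⟨Equiv.swap i N, swap_mem i N⟩ : SInf) (starGen j) := by
  refine Subtype.ext ?_
  change Equiv.swap i N * Equiv.swap 0 j = Equiv.swap 0 j * Equiv.swap i N
  rw [Equiv.mul_swap_eq_swap_mul, Equiv.swap_apply_of_ne_of_ne hi.symm hN.symm,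
    Equiv.swap_apply_of_ne_of_ne hji hjN]

/-- The star generators `(0, N)` have a weak limit `a` in `A_0`. It may replace, one after the
other, the factors of a product of distinct star generators in traces against `A_0`. -/
theorem exists_star_limit (htr : (repAlgebra π).IsFaithfulNormalTracialState tr) :
    ∃ a : (algZero π).Elem, ∀ (l : List ℕ), l.Nodup → 0 ∉ l → ∀ w : (algZero π).Elem,
      tr (StarSubalgebra.inclusion (fixedPoints_le π (tail 2)) w *
          StarSubalgebra.inclusion (fixedPoints_le π (tail 2)) a ^ l.length) =
        tr (StarSubalgebra.inclusion (fixedPoints_le π (tail 2)) w *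
          rep π (l.map starGen).prod) := by
  have hcomm : ∀ h ∈ tail 2, ∀ᶠ N in atTop, Commute h (starGen N) := by
    intro h hh
    filter_upwards [eventually_mem_initial h] with N hN
    refine Subtype.ext ?_
    change (h : Equiv.Perm ℕ) * Equiv.swap 0 N = Equiv.swap 0 N * (h : Equiv.Perm ℕ)
    rw [Equiv.mul_swap_eq_swap_mul, apply_zero_of_mem_tail_two hh, hN N le_rfl]
  obtain ⟨a, ha⟩ := exists_weakTendsto_rep π (tail 2) _ hcomm
  refine ⟨a, fun l => ?_⟩
  induction l with
  | nil =>
    intro _ _ w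
    simp [rep_one]
  | cons i l ih =>
    intro hnd h0 w
    rw [List.nodup_cons] at hnd
    rw [List.mem_cons, not_or] at h0
    have hi : i ≠ 0 := Ne.symm h0.1
    have h1 := ih hnd.2 h0.2 (w * a)
    rw [map_mul (StarSubalgebra.inclusion (fixedPoints_le π (tail 2)))] at h1
    rw [List.length_cons, pow_succ', ← mul_assoc, h1]
    refine trace_mul_weakLimit π htr
      (y := StarSubalgebra.inclusion (fixedPoints_le π (tail 2)) a) ha _ _ ?_
    obtain ⟨B, hB⟩ := l.toFinset.bddAbove
    filter_upwards [eventually_gt_atTop B, eventually_gt_atTop 0] with N hNB hN0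
    -- conjugation by `(i, N)` carries `(0, i)` to `(0, N)` and fixes the other factors
    set g : SInf := ⟨Equiv.swap i N, swap_mem i N⟩ with hg
    have hw := rep_mul_fixed π (swap_mem_tail_two hi hN0.ne') w
    have hgl : Commute g (l.map starGen).prod := by
      refine Commute.list_prod_right _ _ fun x hx => ?_
      obtain ⟨j, hj, rfl⟩ := List.mem_map.1 hx
      have hjB : j ≤ B := hB (by simpa using hj)
      exact swap_commute_starGen hi hN0.ne' (fun h => hnd.1 (h ▸ hj)) (by omega)
    have hprod : starGen N * (l.map starGen).prod =
        g * (starGen i * (l.map starGen).prod) * g⁻¹ := by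
      rw [eq_mul_inv_iff_mul_eq, ← mul_assoc g, conj_swap_starGen hi hN0.ne', mul_assoc, mul_assoc,
        hgl.eq]
    rw [mul_assoc, ← rep_mul, hprod, List.map_cons, List.prod_cons,
      ← trace_rep_conj π htr g (_ * rep π (starGen i * (l.map starGen).prod)), rep_mul, rep_mul,
      ← mul_assoc, ← mul_assoc, ← hw, mul_assoc (rep π g)]

/-- The conditional expectation of a cycle of length `r` onto the center is that of the power
`r - 1` of `E_0(v_1)`. -/
theorem condExp_rep_cycle (htr : (repAlgebra π).IsFaithfulNormalTracialState tr)
    (hEm : IsCondExp (fixedPoints_le π (tail 1)) tr Em)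
    (hE₀ : IsCondExp (fixedPoints_le π (tail 2)) tr E₀) {c : SInf}
    (hc : (c : Equiv.Perm ℕ).IsCycle) :
    Em (rep π c) = Em (StarSubalgebra.inclusion (fixedPoints_le π (tail 2))
      (E₀ (rep π (starGen 1))) ^ ({n | (c : Equiv.Perm ℕ) n ≠ n}.ncard - 1)) := by
  obtain ⟨a, ha⟩ := exists_star_limit π htr
  have hE₀a : E₀ (rep π (starGen 1)) = a := hE₀.eq_of_trace_mul htr fun w => by
    simpa using ha [1] (by simp) (by simp) w
  obtain ⟨x, hx, -⟩ := id hc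
  -- conjugation by `(0, x)` produces a cycle that moves `0`
  set g : SInf := ⟨Equiv.swap 0 x, swap_mem 0 x⟩ with hg
  have hcoe : ((g * c * g⁻¹ : SInf) : Equiv.Perm ℕ) =
      Equiv.swap 0 x * (c : Equiv.Perm ℕ) * (Equiv.swap 0 x)⁻¹ := rfl
  have hcyc : ((g * c * g⁻¹ : SInf) : Equiv.Perm ℕ).IsCycle := hc.conj
  have h0 : ((g * c * g⁻¹ : SInf) : Equiv.Perm ℕ) 0 ≠ 0 := by
    rw [hcoe, Equiv.swap_inv, Equiv.Perm.mul_apply, Equiv.Perm.mul_apply, Equiv.swap_apply_left]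
    intro h
    rw [Equiv.swap_apply_eq_iff, Equiv.swap_apply_left] at h
    exact hx h
  have hcard : {n | ((g * c * g⁻¹ : SInf) : Equiv.Perm ℕ) n ≠ n}.ncard =
      {n | (c : Equiv.Perm ℕ) n ≠ n}.ncard := by
    have : {n | ((g * c * g⁻¹ : SInf) : Equiv.Perm ℕ) n ≠ n} =
        (Equiv.swap 0 x) '' {n | (c : Equiv.Perm ℕ) n ≠ n} := by
      ext n
      rw [Equiv.image_eq_preimage_symm, hcoe, Equiv.swap_inv, Equiv.symm_swap]
      simp only [Set.mem_ofPred_eq, Set.mem_preimage, Equiv.Perm.mul_apply, ne_eq,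
        Equiv.swap_apply_eq_iff]
    rw [this, Set.ncard_image_of_injective _ (Equiv.swap 0 x).injective]
  obtain ⟨l, hnd, hl0, hl, hlen⟩ := exists_starGen_prod _ hcyc h0
  rw [← condExp_rep_conj π htr hEm g c, ← hcard, hlen, Nat.add_sub_cancel, hE₀a, hl]
  refine hEm.eq_of_trace_mul htr fun w => ?_
  have hw : (w : H →L[ℂ] H) ∈ (algZero π).toStarSubalgebra :=
    ⟨w.2.1, fun h _ => w.2.2 h (by rw [tail_one]; trivial)⟩
  rw [hEm.trace_mul]
  exact ha l hnd hl0 ⟨w, hw⟩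

theorem condExp_rep_eq_finprod (htr : (repAlgebra π).IsFaithfulNormalTracialState tr)
    (hEm : IsCondExp (fixedPoints_le π (tail 1)) tr Em)
    (hE₀ : IsCondExp (fixedPoints_le π (tail 2)) tr E₀) (σ : SInf) :
    Em (rep π σ) = ∏ᶠ (k : ℕ) (_ : 2 ≤ k),
      Em (StarSubalgebra.inclusion (fixedPoints_le π (tail 2)) (E₀ (rep π (starGen 1))) ^ (k - 1)) ^
        cycleCount k σ := by
  refine eq_finprod_of_disjoint_mul (fun σ => Em (rep π σ))
    (fun k => Em (StarSubalgebra.inclusion (fixedPoints_le π (tail 2))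
      (E₀ (rep π (starGen 1))) ^ (k - 1))) ?_
    (fun σ τ h => condExp_rep_mul_of_disjoint π htr hEm h)
    (fun c hc => condExp_rep_cycle π htr hEm hE₀ hc) σ
  have h := hEm.proj 1
  rw [map_one] at h
  change Em (rep π 1) = 1
  rw [rep_one, h]

/-! ### Factors -/

/-- If a fixed point algebra is isomorphic to `ℂ`, then its elements are scalars, and the trace
restricts to the isomorphism. -/
theorem trace_inclusion_eq_of_starAlgEquiv (htr : (repAlgebra π).IsFaithfulNormalTracialState tr)
    {G : Subgroup SInf} (e : (fixedPoints π G).Elem ≃⋆ₐ[ℂ] ℂ) (y : (fixedPoints π G).Elem) :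
    tr (StarSubalgebra.inclusion (fixedPoints_le π G) y) = e y := by
  have hy : y = e y • 1 := by
    apply EquivLike.injective e
    rw [map_smul e, map_one e, smul_eq_mul, mul_one]
  conv_lhs => rw [hy]
  rw [map_smul (StarSubalgebra.inclusion _), map_one (StarSubalgebra.inclusion _), map_smul tr,
    htr.map_one, smul_eq_mul, mul_one]

/-- The factor case, with the triviality of the center weakened to multiplicativity of the trace on
the center. -/
theorem trace_rep_eq_finprod_of_mul_center (htr : (repAlgebra π).IsFaithfulNormalTracialState tr)
    (hEm : IsCondExp (fixedPoints_le π (tail 1)) tr Em)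
    (hE₀ : IsCondExp (fixedPoints_le π (tail 2)) tr E₀)
    (hmul : ∀ y z : (algNegOne π).Elem,
      tr (StarSubalgebra.inclusion (fixedPoints_le π (tail 1)) (y * z)) =
        tr (StarSubalgebra.inclusion (fixedPoints_le π (tail 1)) y) *
          tr (StarSubalgebra.inclusion (fixedPoints_le π (tail 1)) z)) (σ : SInf) :
    tr (rep π σ) = ∏ᶠ (k : ℕ) (_ : 2 ≤ k),
      tr (StarSubalgebra.inclusion (fixedPoints_le π (tail 2)) (E₀ (rep π (starGen 1))) ^ (k - 1)) ^
        cycleCount k σ := by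
  refine eq_finprod_of_disjoint_mul (fun σ => tr (rep π σ))
    (fun k => tr (StarSubalgebra.inclusion (fixedPoints_le π (tail 2))
      (E₀ (rep π (starGen 1))) ^ (k - 1))) ?_ (fun σ τ h => ?_) (fun c hc => ?_) σ
  · change tr (rep π 1) = 1
    rw [rep_one, htr.map_one]
  · change tr (rep π (σ * τ)) = tr (rep π σ) * tr (rep π τ)
    rw [← hEm.preserves, condExp_rep_mul_of_disjoint π htr hEm h, hmul, hEm.preserves,
      hEm.preserves]
  · rw [← hEm.preserves, condExp_rep_cycle π htr hEm hE₀ hc, hEm.preserves]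

end SInf

theorem mainTheorem2 {H : Type*} [NormedAddCommGroup H] [InnerProductSpace ℂ H] [CompleteSpace H]
    (π : SInf →* unitary (H →L[ℂ] H))
    (tr : (SInf.repAlgebra π).Elem →ₗ[ℂ] ℂ)
    (htr : (SInf.repAlgebra π).IsFaithfulNormalTracialState tr) :
    -- the trace-preserving conditional expectations onto `A_{-1}` and `A_0` exist and are unique
    (∃! E : (SInf.repAlgebra π).Elem →ₗ[ℂ] (SInf.algNegOne π).Elem,
      VonNeumannAlgebra.IsCondExp (SInf.fixedPoints_le π (SInf.tail 1)) tr E) ∧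
    (∃! E : (SInf.repAlgebra π).Elem →ₗ[ℂ] (SInf.algZero π).Elem,
      VonNeumannAlgebra.IsCondExp (SInf.fixedPoints_le π (SInf.tail 2)) tr E) ∧
    ∀ (Em : (SInf.repAlgebra π).Elem →ₗ[ℂ] (SInf.algNegOne π).Elem)
      (E₀ : (SInf.repAlgebra π).Elem →ₗ[ℂ] (SInf.algZero π).Elem),
      VonNeumannAlgebra.IsCondExp (SInf.fixedPoints_le π (SInf.tail 1)) tr Em →
      VonNeumannAlgebra.IsCondExp (SInf.fixedPoints_le π (SInf.tail 2)) tr E₀ →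
      ∀ σ : SInf,
        -- multiplicativity of `E_{-1}`
        Em (SInf.rep π σ) =
          ∏ᶠ (k : ℕ) (_ : 2 ≤ k),
            Em ((StarSubalgebra.inclusion (SInf.fixedPoints_le π (SInf.tail 2))
              (E₀ (SInf.rep π (SInf.starGen 1)))) ^ (k - 1)) ^ SInf.cycleCount k σ ∧
        -- the factor case
        (Nonempty ((SInf.algNegOne π).Elem ≃⋆ₐ[ℂ] ℂ) →
          tr (SInf.rep π σ) =
            ∏ᶠ (k : ℕ) (_ : 2 ≤ k),
              tr ((StarSubalgebra.inclusion (SInf.fixedPoints_le π (SInf.tail 2))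
                (E₀ (SInf.rep π (SInf.starGen 1)))) ^ (k - 1)) ^ SInf.cycleCount k σ) ∧
        -- the case of a trivial algebra `A_0`
        (Nonempty ((SInf.algZero π).Elem ≃⋆ₐ[ℂ] ℂ) →
          tr (SInf.rep π σ) =
            ∏ᶠ (k : ℕ) (_ : 2 ≤ k),
              tr (SInf.rep π (SInf.starGen 1)) ^ ((k - 1) * SInf.cycleCount k σ)) := by
  refine ⟨?_, ?_, fun Em E₀ hEm hE₀ σ => ⟨SInf.condExp_rep_eq_finprod π htr hEm hE₀ σ, ?_, ?_⟩⟩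
  · obtain ⟨E, hE⟩ := SInf.exists_isCondExp π htr (SInf.tail 1)
    exact ⟨E, hE, fun E' hE' => VonNeumannAlgebra.IsCondExp.unique htr hE' hE⟩
  · obtain ⟨E, hE⟩ := SInf.exists_isCondExp π htr (SInf.tail 2)
    exact ⟨E, hE, fun E' hE' => VonNeumannAlgebra.IsCondExp.unique htr hE' hE⟩
  · rintro ⟨e⟩
    refine SInf.trace_rep_eq_finprod_of_mul_center π htr hEm hE₀ (fun y z => ?_) σ
    have h := SInf.trace_inclusion_eq_of_starAlgEquiv π htr e
    rw [h, h, h, map_mul]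
  · rintro ⟨e⟩
    have h := SInf.trace_inclusion_eq_of_starAlgEquiv π htr e
    -- the center is contained in `A_0`, so that the trace is multiplicative on it as well
    have hle : ∀ w : (SInf.algNegOne π).Elem,
        (w : H →L[ℂ] H) ∈ (SInf.algZero π).toStarSubalgebra := fun w =>
      ⟨w.2.1, fun g _ => w.2.2 g (by rw [SInf.tail_one]; trivial)⟩
    have hmul : ∀ y z : (SInf.algNegOne π).Elem,
        tr (StarSubalgebra.inclusion (SInf.fixedPoints_le π (SInf.tail 1)) (y * z)) =
          tr (StarSubalgebra.inclusion (SInf.fixedPoints_le π (SInf.tail 1)) y) *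
            tr (StarSubalgebra.inclusion (SInf.fixedPoints_le π (SInf.tail 1)) z) := by
      intro y z
      have h1 := h (⟨y, hle y⟩ * ⟨z, hle z⟩)
      rw [map_mul e, ← h, ← h] at h1
      exact h1
    rw [SInf.trace_rep_eq_finprod_of_mul_center π htr hEm hE₀ hmul σ]
    refine finprod_congr fun k => finprod_congr fun _ => ?_
    have ha : tr (SInf.rep π (SInf.starGen 1)) = e (E₀ (SInf.rep π (SInf.starGen 1))) := by
      rw [← hE₀.preserves, h]
    rw [ha, ← map_pow (StarSubalgebra.inclusion _), h, map_pow e, pow_mul]
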